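/- **Setting.** Write $\mathbb H$ for the quaternions and $\mathcal H=\{h+\varepsilon h' : h,h'\in\mathbb H\}$, $\varepsilon^2=0$, for the dual quaternions, with conjugation $(h+\varepsilon h')^*=h^*+\varepsilon h'^*$. A *pose* is a unit dual quaternion, i.e. $x\in\underline{\mathcal S}=\{x\in\mathcal H : xx^*=1\}$; it is written $x=r+\varepsilon\tfrac12 p\,r$ with a unit quaternion $r$ (rotation) and a pure quaternion $p$ (translation). If $r\neq-1$, write $r=\cos(\phi/2)+\sin(\phi/2)\,n$ with $\phi\in[0,2\pi)$ and $n$ a pure unit quaternion, and put $\log r=\tfrac{\phi}{2}n$ and $\log x=\log r+\varepsilon\tfrac12 p$. Let $\mathrm{vec}_4$ and $\mathrm{vec}_8$ be the coefficient vectors of quaternions and dual quaternions, $\mathrm{vec}_3$ and $\mathrm{vec}_6$ those of the imaginary parts of pure quaternions and pure dual quaternions. Let $H_4^{+}(h)$, $H_4^{-}(h)$ be the matrices with $\mathrm{vec}_4(hk)=H_4^+(h)\,\mathrm{vec}_4 k$ and $\mathrm{vec}_4(kh)=H_4^-(h)\,\mathrm{vec}_4 k$, and put $$Q_8(x)=\begin{bmatrix}Q(r)&0\\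 \tfrac12H_4^+(p)Q(r)&H_4^-(r)Q_p\end{bmatrix}\in\mathbb R^{8\times6},\qquad Q_p=\begin{bmatrix}0_{1\times 3}\\ I_3\end{bmatrix},$$ where $Q(r)\in\mathbb R^{4\times3}$ is the Jacobian $\partial\,\mathrm{vec}_4(\exp y)/\partial\,\mathrm{vec}_3\,y$ (for pure $y$) at $y=\log r$. Let $n\ge1$ and let $\mathcal G$ be a simple weighted directed graph on $\{1,\dots,n\}$ with weights $a_{ij}>0$ if there is an edge from $j$ to $i$ and $a_{ij}=0$ otherwise (in particular $a_{ii}=0$). A *directed spanning tree* of $\mathcal G$ is a subgraph containing all vertices in which one vertex (the root) has no parent, every other vertex has exactly one parent, and there is a directed path from the root to every vertex. Consider $n$ rigid-body agents with poses $x_i(t)\in\underline{\mathcal S}$, $t\ge0$, kinematics $\mathrm{vec}_8\,\dot x_i=\mathrm{vec}_8\,u_i$, outputs $y_i=\log x_i$ and the protocol $$\mathrm{vec}_8\,u_i=-Q_8(x_i)\sum_{j=1}^n a_{ij}\,\mathrm{vec}_6(y_i-y_j),\qquad i=1,\dots,n.$$ A *trajectory* is a solution of this closed loop on $[0,\infty)$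 whose initial poses have rotations $r_i(0)\ne-1$. (To write the equation for all $t$ before knowing (1), read $\log(-1)$ as $0$; by (1) this value is never used.) **Theorem.** 1. For all initial poses with rotations $\neq-1$ there is a trajectory starting there, and along every trajectory all rotations $r_i(t)$, $t\ge 0$, remain different from $-1$, so that the outputs $y_i(t)=\log x_i(t)$ stay defined. 2. The multi-agent system achieves output consensus (that is, $\lim_{t\to\infty}(y_i(t)-y_j(t))=0$ for all $i,j$ along every trajectory) if and only if $\mathcal G$ has a directed spanning tree. 3. Every trajectory along which $y_i(t)-y_j(t)\to0$ for all $i,j$ also achieves pose consensus: there is a pose $x_c\in\underline{\mathcal S}$ with $\lim_{t\to\infty}x_i(t)=x_c$ for all $i$. -/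

import Mathlib

open scoped Quaternion Topology Matrix
open Filter

noncomputable section

namespace RigidBody

/-! ### Weighted directed graphs -/

/-- A simple weighted directed graph on the vertices `Fin n`. `Adj i j` means that there is an edge
from the parent `i` to the child `j`. The weight `a i j` belongs to the edge from `j` to `i`: it is
positive if this edge exists and zero otherwise. -/
structure WeightedDigraph (n : ℕ) extends Digraph (Fin n) where
  /-- the adjacency matrix -/
  a : Matrix (Fin n) (Fin n) ℝ
  loopless : ∀ i, ¬ Adj i i
  weight_pos : ∀ i j, Adj j i → 0 < a i j
  weight_eq_zero : ∀ i j, ¬ Adj j i → a i j = 0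

/-- `T` is a directed tree with root `r` containing all vertices: the root has no parent, every
other vertex has exactly one parent, and every vertex is reached from the root by a directed path
(which is then unique). -/
structure IsDirectedTree {V : Type*} (T : Digraph V) (r : V) : Prop where
  root_no_parent : ∀ i, ¬ T.Adj i r
  unique_parent : ∀ j, j ≠ r → ∃! i, T.Adj i j
  path_from_root : ∀ j, Relation.ReflTransGen T.Adj r j

/-- Some directed tree containing all vertices is obtained from `G` by removing edges. -/
def HasDirectedSpanningTree {V : Type*} (G : Digraph V) : Prop :=
  ∃ T : Digraph V, T ≤ G ∧ ∃ r : V, IsDirectedTree T r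

/-! ### Quaternions -/

/-- The coefficients of a quaternion as a vector of `ℝ⁴`. -/
def vec4 (h : ℍ[ℝ]) : Fin 4 → ℝ := ![h.re, h.imI, h.imJ, h.imK]

/-- The imaginary coefficients of a (pure) quaternion as a vector of `ℝ³`. -/
def vec3 (h : ℍ[ℝ]) : Fin 3 → ℝ := ![h.imI, h.imJ, h.imK]

/-- The pure quaternion with the given imaginary coefficients (the inverse of `vec3`). -/
def pureOfVec (v : Fin 3 → ℝ) : ℍ[ℝ] := ⟨0, v 0, v 1, v 2⟩

/-- The Hamilton operator with `vec4 (h * k) = hamPlus4 h *ᵥ vec4 k`. -/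
def hamPlus4 (h : ℍ[ℝ]) : Matrix (Fin 4) (Fin 4) ℝ :=
  !![h.re, -h.imI, -h.imJ, -h.imK;
     h.imI, h.re, -h.imK, h.imJ;
     h.imJ, h.imK, h.re, -h.imI;
     h.imK, -h.imJ, h.imI, h.re]

/-- The Hamilton operator with `vec4 (k * h) = hamMinus4 h *ᵥ vec4 k`. -/
def hamMinus4 (h : ℍ[ℝ]) : Matrix (Fin 4) (Fin 4) ℝ :=
  !![h.re, -h.imI, -h.imJ, -h.imK;
     h.imI, h.re, h.imK, -h.imJ;
     h.imJ, -h.imK, h.re, h.imI;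
     h.imK, h.imJ, -h.imI, h.re]

/-- The logarithm of a unit quaternion `r = cos (φ/2) + sin (φ/2) n ≠ -1`, with `φ ∈ [0, 2π)` and
`n` a pure unit quaternion: the pure quaternion `(φ/2) n`. Here `φ/2 = arccos (Re r)` and
`n = Im r / ‖Im r‖`. (At `r = -1`, where the axis is not determined and `φ = 2π` is excluded, the
value of this expression is `0`.) -/
def quatLog (r : ℍ[ℝ]) : ℍ[ℝ] := (Real.arccos r.re / ‖r.im‖) • r.im

/-- `Q(r)`, the `4 × 3` Jacobian matrix `∂ vec4 r / ∂ vec3 y` of `r = exp y`, `y` a pure quaternion,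
taken at `y = log r`. -/
def Q (r : ℍ[ℝ]) : Matrix (Fin 4) (Fin 3) ℝ :=
  LinearMap.toMatrix'
    (fderiv ℝ (fun v : Fin 3 → ℝ => vec4 (NormedSpace.exp (pureOfVec v)))
      (vec3 (quatLog r))).toLinearMap

/-- The `4 × 3` matrix with a zero row on top of the identity. -/
def Qp : Matrix (Fin 4) (Fin 3) ℝ :=
  !![0, 0, 0;
     1, 0, 0;
     0, 1, 0;
     0, 0, 1]

/-! ### Dual quaternions -/

/-- Dual quaternions `h + ε h'`; `h` is `TrivSqZeroExt.fst` and `h'` is `TrivSqZeroExt.snd`. -/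
abbrev DualQuat : Type := DualNumber ℍ[ℝ]

/-- The dual quaternion `h + ε h'`. -/
def mkDQ (h h' : ℍ[ℝ]) : DualQuat := TrivSqZeroExt.inl h + TrivSqZeroExt.inr h'

/-- The conjugate `Re x - Im x` of a dual quaternion. -/
def conj (x : DualQuat) : DualQuat := mkDQ (star x.fst) (star x.snd)

/-- Unit dual quaternions, `x x* = 1`: the poses of rigid bodies. -/
def unitDQ : Set DualQuat := {x | x * conj x = 1}

/-- The rotation `r` of a pose `x = r + ε (1/2) p r`. -/
def rot (x : DualQuat) : ℍ[ℝ] := x.fst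

/-- The translation `p` of a pose `x = r + ε (1/2) p r`, that is `p = 2 x' r*`. -/
def trans (x : DualQuat) : ℍ[ℝ] := (2 : ℝ) • (x.snd * star x.fst)

/-- The poses with a logarithm: unit dual quaternions with rotation different from `-1`
(rotation angle in `[0, 2π)`). -/
def logDomain : Set DualQuat := {x | x ∈ unitDQ ∧ rot x ≠ -1}

/-- The logarithm `log r + ε (1/2) p = (1/2) (φ n + ε p)` of a pose. -/
def logDQ (x : DualQuat) : DualQuat := mkDQ (quatLog (rot x)) ((1 / 2 : ℝ) • trans x)

/-- The coefficients of a dual quaternion as a vector of `ℝ⁸ = ℝ⁴ × ℝ⁴`. -/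
def vec8 (x : DualQuat) : Fin 4 ⊕ Fin 4 → ℝ := Sum.elim (vec4 x.fst) (vec4 x.snd)

/-- The imaginary coefficients of a (pure) dual quaternion as a vector of `ℝ⁶ = ℝ³ × ℝ³`. -/
def vec6 (y : DualQuat) : Fin 3 ⊕ Fin 3 → ℝ := Sum.elim (vec3 y.fst) (vec3 y.snd)

/-- The `8 × 6` matrix `Q₈(x)`, in blocks. -/
def Q8 (x : DualQuat) : Matrix (Fin 4 ⊕ Fin 4) (Fin 3 ⊕ Fin 3) ℝ :=
  Matrix.fromBlocks
    (Q (rot x)) 0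
    ((1 / 2 : ℝ) • (hamPlus4 (trans x) * Q (rot x))) (hamMinus4 (rot x) * Qp)

/-! ### The multi-agent system -/

variable {n : ℕ}

/-- The input `vec8 u_i = - Q₈(x_i) ∑ j, a_ij vec6 (y_i - y_j)` prescribed to agent `i` by the
protocol when the poses are `x`, where `y_i = log x_i`. -/
def protocolInput (G : WeightedDigraph n) (x : Fin n → DualQuat) (i : Fin n) :
    Fin 4 ⊕ Fin 4 → ℝ :=
  -(Q8 (x i) *ᵥ ∑ j, G.a i j • vec6 (logDQ (x i) - logDQ (x j)))

/-- `x` is a trajectory, on the times `t ≥ 0`, of the kinematics `vec8 (dx_i/dt) = vec8 u_i` under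
the protocol: the `x_i(t)` are poses, those at time `0` have a logarithm, and the differential
equation holds (at `t = 0` with the right derivative). -/
structure IsTrajectory (G : WeightedDigraph n) (x : ℝ → Fin n → DualQuat) : Prop where
  unit : ∀ t, 0 ≤ t → ∀ i, x t i ∈ unitDQ
  initial : ∀ i, x 0 i ∈ logDomain
  ode : ∀ t, 0 ≤ t → ∀ i,
    HasDerivWithinAt (fun s => vec8 (x s i)) (protocolInput G (x t) i) (Set.Ici 0) t

/-- Output consensus: `y_i(t) - y_j(t) → 0` as `t → ∞` for all `i, j`, where `y_i = log x_i`. -/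
def OutputConsensus (x : ℝ → Fin n → DualQuat) : Prop :=
  ∀ i j, Tendsto (fun t => logDQ (x t i) - logDQ (x t j)) atTop (𝓝 0)

/-- Pose consensus: all poses converge to a common pose. -/
def PoseConsensus (x : ℝ → Fin n → DualQuat) : Prop :=
  ∃ c ∈ unitDQ, ∀ i, Tendsto (fun t => x t i) atTop (𝓝 c)

end RigidBody

end

/-!
In logarithmic coordinates the closed loop is linear. Write `v_i = log r_i` and `w_i = p_i / 2`, so
that `y_i = v_i + ε w_i`. The matrix `Q₈(x)` is the derivative of `v + ε w ↦ exp v + ε w exp v`, hence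
the protocol makes both families `v` and `w` solve the linear consensus equation
`z_i' = -∑ j, a_ij (z_i - z_j)`, as long as no rotation is `-1`
(`IsTrajectory.hasDerivWithinAt_quatLog`, `IsTrajectory.hasDerivWithinAt_halfTrans`). The logarithm
is not differentiated for this: the derivative `Q(r)` of `exp` is injective in the ball of radius
`π` (`Q_mulVec_eq_zero`), so `exp` is an immersion there, and a curve whose image under an immersion
is differentiable is itself differentiable once it is continuous
(`RigidBody.hasDerivWithinAt_quatLog`).

The solutions of the linear equation are `z(t) = exp (-t L) z(0)` with the Laplacian `L`
(`eq_act_transition`). Since `L` kills constants and `c - L` has nonnegative entries for large `c`,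
the matrix `exp (-t L)` is stochastic for `t ≥ 0`, and by the exponential series of `t (c - L)` its
entry `(i, j)` is positive for `t > 0` if and only if `i` is reached from `j`. Everything follows.

* All `v_i(t)` stay in the smallest ball around `0` that contains the `v_i(0)`, whose radius is less
  than `π`; by continuity no rotation ever becomes `-1` (`IsTrajectory.rot_ne_neg_one`), and
  exponentiating the linear solution gives a trajectory (`exists_isTrajectory`).
* A directed spanning tree exists if and only if some vertex `r` reaches all others
  (`hasDirectedSpanningTree_iff`). In this case the column `r` of `exp (-L)` is bounded below by some
  `δ > 0`, and the diameter of the set of states shrinks by the factor `1 - δ` per unit of time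
  (`tendsto_act_transition_sub`). Otherwise some vertices `i` and `j` have no common ancestor
  (`exists_forall_reflTransGen`), and starting the ancestors of `i` in one state and the other
  agents in a different one keeps `i` and `j` apart (`exists_common_ancestor`).
* From any time on, the states stay in the convex hull of the states at that time. So once their
  diameter tends to `0` they are Cauchy, the outputs converge, and so do the poses
  (`exists_tendsto_act_transition`, `IsTrajectory.poseConsensus`).
-/

noncomputable section

namespace RigidBody

/-! ### Linear consensus on a normed space -/

section Consensus

variable {ι : Type*} [Fintype ι]
variable {E : Type*} [NormedAddCommGroup E] [NormedSpace ℝ E]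

/-- The action of a real matrix on families of vectors. -/
def act (P : Matrix ι ι ℝ) (z : ι → E) (i : ι) : E := ∑ j, P i j • z j

theorem act_act (P R : Matrix ι ι ℝ) (z : ι → E) : act P (act R z) = act (P * R) z := by
  funext i
  simp only [act, Matrix.mul_apply, Finset.smul_sum, Finset.sum_smul, smul_smul]
  exact Finset.sum_comm

theorem norm_act_sub_le {P : Matrix ι ι ℝ} (hP : ∀ i j, 0 ≤ P i j)
    (hP1 : ∀ i, ∑ j, P i j = 1) {z : ι → E} {w : E} {D : ℝ} (hD : ∀ j, ‖z j - w‖ ≤ D) (i : ι) :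
    ‖act P z i - w‖ ≤ D := by
  have h : act P z i - w = ∑ j, P i j • (z j - w) := by
    simp only [act, smul_sub, Finset.sum_sub_distrib, ← Finset.sum_smul, hP1, one_smul]
  rw [h]
  calc ‖∑ j, P i j • (z j - w)‖ ≤ ∑ j, P i j * D := by
        refine norm_sum_le_of_le _ fun j _ => ?_
        rw [norm_smul, Real.norm_of_nonneg (hP i j)]
        exact mul_le_mul_of_nonneg_left (hD j) (hP i j)
    _ = D := by rw [← Finset.sum_mul, hP1, one_mul]

variable [DecidableEq ι]

/-- The graph Laplacian of the weights `a`: the row sums on the diagonal, minus `a`. -/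
def laplacian (a : Matrix ι ι ℝ) : Matrix ι ι ℝ :=
  Matrix.diagonal (fun i => ∑ j, a i j) - a

/-- The matrix `exp (-t L)` that takes the states at time `0` of the linear consensus protocol to
the states at time `t`. -/
def transition (a : Matrix ι ι ℝ) (t : ℝ) : Matrix ι ι ℝ :=
  NormedSpace.exp (t • -laplacian a)

theorem one_act (z : ι → E) : act 1 z = z := by
  funext i
  simp [act, Matrix.one_apply]

theorem neg_laplacian_act (a : Matrix ι ι ℝ) (z : ι → E) (i : ι) :
    act (-laplacian a) z i = -∑ j, a i j • (z i - z j) := by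
  simp only [act, laplacian, Matrix.neg_apply, Matrix.sub_apply, Matrix.diagonal_apply, neg_smul,
    sub_smul, ite_smul, zero_smul, Finset.sum_neg_distrib, Finset.sum_sub_distrib,
    Finset.sum_ite_eq, Finset.mem_univ, if_true, smul_sub, Finset.sum_smul]

section Exponential

-- any algebra norm on matrices serves here; the exponential depends only on the topology
attribute [local instance] Matrix.linftyOpNormedRing Matrix.linftyOpNormedAlgebra

theorem transition_zero (a : Matrix ι ι ℝ) : transition a 0 = 1 := by
  simp [transition, NormedSpace.exp_zero]

theorem transition_add (a : Matrix ι ι ℝ) (s t : ℝ) :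
    transition a (s + t) = transition a s * transition a t := by
  rw [transition, add_smul, Matrix.exp_add_of_commute]
  · rfl
  · exact ((Commute.refl _).smul_left s).smul_right t

theorem hasDerivAt_transition (a : Matrix ι ι ℝ) (t : ℝ) (i j : ι) :
    HasDerivAt (fun t => transition a t i j) ((-laplacian a * transition a t) i j) t := by
  have h := hasDerivAt_exp_smul_const' (𝕂 := ℝ) (-laplacian a) t
  exact hasDerivAt_pi.1 (hasDerivAt_pi.1 h i) j

theorem hasDerivAt_transition' (a : Matrix ι ι ℝ) (t : ℝ) (i j : ι) :
    HasDerivAt (fun t => transition a t i j) ((transition a t * -laplacian a) i j) t := by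
  have h := hasDerivAt_exp_smul_const (𝕂 := ℝ) (-laplacian a) t
  exact hasDerivAt_pi.1 (hasDerivAt_pi.1 h i) j

/-- The matrix `c - L`, with `c` the sum of all weights. It differs from `-L` by a scalar matrix, and
its entries are nonnegative if the weights are. -/
def shiftedWeights (a : Matrix ι ι ℝ) : Matrix ι ι ℝ :=
  (∑ i, ∑ j, a i j) • (1 : Matrix ι ι ℝ) - laplacian a

/-- The exponential series of `t (c - L)`, rescaled, sums to `exp (-t L)`. All information about
the signs of the entries of the transition matrix comes from here. -/
theorem hasSum_transition (a : Matrix ι ι ℝ) (t : ℝ) (i j : ι) :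
    HasSum (fun k : ℕ => Real.exp (-(t * ∑ i, ∑ j, a i j)) *
      ((k.factorial : ℝ)⁻¹ * (t ^ k * (shiftedWeights a ^ k) i j))) (transition a t i j) := by
  set c := ∑ i, ∑ j, a i j with hc
  have h1 : transition a t = Real.exp (-(t * c)) • NormedSpace.exp (t • shiftedWeights a) := by
    have : t • -laplacian a = algebraMap ℝ (Matrix ι ι ℝ) (-(t * c)) + t • shiftedWeights a := by
      rw [shiftedWeights, ← hc, Algebra.algebraMap_eq_smul_one, smul_sub, smul_smul, neg_smul,
        smul_neg]
      abel
    rw [transition, this, Matrix.exp_add_of_commute _ _ (Algebra.commute_algebraMap_left _ _),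
      show NormedSpace.exp (algebraMap ℝ (Matrix ι ι ℝ) (-(t * c))) =
        algebraMap ℝ (Matrix ι ι ℝ) (NormedSpace.exp (-(t * c))) from
        (NormedSpace.algebraMap_exp_comm _).symm,
      Algebra.algebraMap_eq_smul_one, smul_mul_assoc, one_mul, Real.exp_eq_exp_ℝ]
  have h2 := NormedSpace.exp_series_hasSum_exp' (𝕂 := ℝ) (t • shiftedWeights a)
  have h3 : HasSum (fun k : ℕ => (((k.factorial : ℝ)⁻¹ • (t • shiftedWeights a) ^ k) i j))
      (NormedSpace.exp (t • shiftedWeights a) i j) := Pi.hasSum.1 (Pi.hasSum.1 h2 i) j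
  rw [h1]
  have h4 := h3.mul_left (Real.exp (-(t * c)))
  simpa [smul_pow] using h4

end Exponential

section Sign

variable {a : Matrix ι ι ℝ} (ha : ∀ i j, 0 ≤ a i j)
include ha

theorem le_shiftedWeights (i j : ι) : a i j ≤ shiftedWeights a i j := by
  have h : ∑ j, a i j ≤ ∑ i, ∑ j, a i j :=
    Finset.single_le_sum (f := fun i => ∑ j, a i j)
      (fun i _ => Finset.sum_nonneg fun j _ => ha i j) (Finset.mem_univ i)
  by_cases hij : i = j
  · subst hij
    simp [shiftedWeights, laplacian]
    linarith
  · simp [shiftedWeights, laplacian, hij]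

theorem shiftedWeights_pow_nonneg (k : ℕ) (i j : ι) : 0 ≤ (shiftedWeights a ^ k) i j := by
  induction k generalizing i j with
  | zero => rw [pow_zero, Matrix.one_apply]; split_ifs <;> simp
  | succ k ih =>
    rw [pow_succ, Matrix.mul_apply]
    exact Finset.sum_nonneg fun l _ =>
      mul_nonneg (ih i l) ((ha l j).trans (le_shiftedWeights ha l j))

/-- A directed walk with `k` edges from `j` to `i` contributes to the entry `(i, j)` of the `k`-th
power. -/
theorem exists_shiftedWeights_pow_pos {i j : ι}
    (h : Relation.ReflTransGen (fun j i => a i j ≠ 0) j i) :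
    ∃ k, 0 < (shiftedWeights a ^ k) i j := by
  induction h with
  | refl => exact ⟨0, by simp⟩
  | @tail l i _ hl ih =>
    obtain ⟨k, hk⟩ := ih
    refine ⟨k + 1, ?_⟩
    rw [pow_succ', Matrix.mul_apply]
    have hpos : 0 < shiftedWeights a i l :=
      lt_of_lt_of_le (lt_of_le_of_ne (ha i l) (Ne.symm hl)) (le_shiftedWeights ha i l)
    refine Finset.sum_pos' (fun m _ => mul_nonneg ?_ (shiftedWeights_pow_nonneg ha k m j))
      ⟨l, Finset.mem_univ l, mul_pos hpos hk⟩
    exact (ha i m).trans (le_shiftedWeights ha i m)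

theorem transition_nonneg {t : ℝ} (ht : 0 ≤ t) (i j : ι) : 0 ≤ transition a t i j :=
  (hasSum_transition a t i j).nonneg fun k => by
    have := shiftedWeights_pow_nonneg ha k i j
    positivity

theorem transition_pos {t : ℝ} (ht : 0 < t) {i j : ι}
    (h : Relation.ReflTransGen (fun j i => a i j ≠ 0) j i) : 0 < transition a t i j := by
  obtain ⟨k, hk⟩ := exists_shiftedWeights_pow_pos ha h
  refine lt_of_lt_of_le ?_ (le_hasSum (hasSum_transition a t i j) k fun k _ => ?_)
  · positivity
  · have := shiftedWeights_pow_nonneg ha k i j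
    positivity

end Sign

theorem shiftedWeights_pow_eq_zero {a : Matrix ι ι ℝ} {i j : ι}
    (h : ¬ Relation.ReflTransGen (fun j i => a i j ≠ 0) j i) (k : ℕ) :
    (shiftedWeights a ^ k) i j = 0 := by
  induction k generalizing i with
  | zero =>
    have : i ≠ j := by rintro rfl; exact h .refl
    simp [this]
  | succ k ih =>
    rw [pow_succ', Matrix.mul_apply]
    refine Finset.sum_eq_zero fun l _ => ?_
    by_cases hl : Relation.ReflTransGen (fun j i => a i j ≠ 0) j l
    · have hil : i ≠ l := by rintro rfl; exact h hl
      have hal : a i l = 0 := by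
        by_contra hal
        exact h (hl.tail hal)
      simp [shiftedWeights, laplacian, hil, hal]
    · rw [ih hl, mul_zero]

/-- The state of `i` depends only on the initial states of the ancestors of `i`. -/
theorem transition_eq_zero {a : Matrix ι ι ℝ} (t : ℝ) {i j : ι}
    (h : ¬ Relation.ReflTransGen (fun j i => a i j ≠ 0) j i) : transition a t i j = 0 := by
  refine (hasSum_transition a t i j).unique ?_
  simp [shiftedWeights_pow_eq_zero h, hasSum_zero]

theorem transition_row_sum (a : Matrix ι ι ℝ) (t : ℝ) (i : ι) : ∑ j, transition a t i j = 1 := by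
  have hL : ∀ t, HasDerivAt (fun t => ∑ j, transition a t i j) 0 t := fun t => by
    have h := HasDerivAt.fun_sum fun j (_ : j ∈ Finset.univ) => hasDerivAt_transition' a t i j
    refine h.congr_deriv ?_
    simp only [Matrix.mul_apply]
    rw [Finset.sum_comm]
    refine Finset.sum_eq_zero fun l _ => ?_
    rw [← Finset.mul_sum]
    simp [laplacian, Matrix.diagonal_apply]
  have h := is_const_of_deriv_eq_zero (fun t => (hL t).differentiableAt) (fun t => (hL t).deriv) t 0
  rw [h, transition_zero]
  simp [Matrix.one_apply]

theorem hasDerivAt_act_transition (a : Matrix ι ι ℝ) (z : ι → E) (t : ℝ) (i : ι) :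
    HasDerivAt (fun t => act (transition a t) z i)
      (-∑ j, a i j • (act (transition a t) z i - act (transition a t) z j)) t := by
  rw [← neg_laplacian_act, act_act]
  exact HasDerivAt.fun_sum fun j _ => (hasDerivAt_transition a t i j).smul_const (z j)

/-- Solutions of the linear consensus equation on a bounded interval are given by the transition
matrix. -/
theorem eq_act_transition {a : Matrix ι ι ℝ} {z : ℝ → ι → E} {T : ℝ} (hT : 0 ≤ T)
    (h : ∀ t ∈ Set.Icc 0 T, ∀ i, HasDerivWithinAt (fun s => z s i)
      (-∑ j, a i j • (z t i - z t j)) (Set.Ici 0) t) :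
    z T = act (transition a T) (z 0) := by
  funext i
  -- propagating `z s` for the remaining time `T - s` gives a constant function of `s`
  have hd : ∀ s ∈ Set.Icc 0 T, HasDerivWithinAt (fun s => act (transition a (T - s)) (z s) i) 0
      (Set.Ici 0) s := fun s hs => by
    have h1 : ∀ j, HasDerivWithinAt (fun s => transition a (T - s) i j)
        (-(transition a (T - s) * -laplacian a) i j) (Set.Ici 0) s := fun j => by
      have := (hasDerivAt_transition' a (T - s) i j).scomp s ((hasDerivAt_id s).const_sub T)
      simpa [Function.comp_def] using this.hasDerivWithinAt
    have h2 := HasDerivWithinAt.fun_sum fun j (_ : j ∈ Finset.univ) => (h1 j).smul (h s hs j)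
    refine h2.congr_deriv ?_
    have h3 : act (transition a (T - s)) (act (-laplacian a) (z s)) i =
        act (transition a (T - s) * -laplacian a) (z s) i := by rw [act_act]
    simp only [← neg_laplacian_act, Finset.sum_add_distrib, neg_smul, Finset.sum_neg_distrib]
    simp only [act] at h3 ⊢
    rw [h3, add_neg_cancel]
  have hc := constant_of_has_deriv_right_zero
    (f := fun s => act (transition a (T - s)) (z s) i) (a := 0) (b := T)
    (fun s hs => ((hd s hs).continuousWithinAt).mono fun u hu => hu.1)
    (fun s hs => (hd s ⟨hs.1, hs.2.le⟩).mono (Set.Ici_subset_Ici.2 hs.1))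
    T ⟨hT, le_rfl⟩
  simpa [transition_zero, one_act] using hc

section Stochastic

variable {P : Matrix ι ι ℝ} (hP : ∀ i j, 0 ≤ P i j) (hP1 : ∀ i, ∑ j, P i j = 1)
include hP hP1

/-- A stochastic matrix with a column bounded below by `δ` contracts the diameter of the set of
states by the factor `1 - δ`: all rows share the mass `δ` at that column. -/
theorem norm_act_sub_act_le {z : ι → E} {D δ : ℝ} {r : ι} (hδ : ∀ i, δ ≤ P i r)
    (hD : ∀ i j, ‖z i - z j‖ ≤ D) (i j : ι) : ‖act P z i - act P z j‖ ≤ (1 - δ) * D := by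
  -- `q` is `P` without the shared mass: nonnegative, with all row sums `1 - δ`
  let q : Matrix ι ι ℝ := fun i k => P i k - if k = r then δ else 0
  have hq : ∀ i k, 0 ≤ q i k := fun i k => by
    simp only [q]
    split_ifs with h
    · subst h; linarith [hδ i]
    · simpa using hP i k
  have hq1 : ∀ i, ∑ k, q i k = 1 - δ := fun i => by
    simp [q, Finset.sum_sub_distrib, hP1]
  have hact : ∀ i, act P z i = act q z i + δ • z r := fun i => by
    simp [act, q, sub_smul, Finset.sum_sub_distrib, ite_smul]
  rw [hact, hact, add_sub_add_right_eq_sub]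
  rcases eq_or_lt_of_le (show 0 ≤ 1 - δ from hq1 i ▸ Finset.sum_nonneg fun k _ => hq i k)
    with h0 | hpos
  · have hq0 : ∀ i k, q i k = 0 := fun i k =>
      (Finset.sum_eq_zero_iff_of_nonneg fun k _ => hq i k).1 ((hq1 i).trans h0.symm) k
        (Finset.mem_univ k)
    simp [act, hq0, ← h0]
  · have key : (1 - δ) • (act q z i - act q z j) =
        ∑ k, ∑ l, (q i k * q j l) • (z k - z l) := by
      simp only [smul_sub, Finset.sum_sub_distrib]
      congr 1
      · simp only [act, Finset.smul_sum, smul_smul]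
        refine Finset.sum_congr rfl fun k _ => ?_
        rw [← Finset.sum_smul, ← Finset.mul_sum, hq1, mul_comm]
      · rw [Finset.sum_comm]
        simp only [act, Finset.smul_sum, smul_smul]
        refine Finset.sum_congr rfl fun k _ => ?_
        rw [← Finset.sum_smul, ← Finset.sum_mul, hq1]
    have hle : ‖(1 - δ) • (act q z i - act q z j)‖ ≤ (1 - δ) * ((1 - δ) * D) := by
      rw [key]
      calc ‖∑ k, ∑ l, (q i k * q j l) • (z k - z l)‖ ≤ ∑ k, ∑ l, q i k * q j l * D := by
            refine norm_sum_le_of_le _ fun k _ => norm_sum_le_of_le _ fun l _ => ?_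
            have := mul_nonneg (hq i k) (hq j l)
            rw [norm_smul, Real.norm_of_nonneg this]
            exact mul_le_mul_of_nonneg_left (hD k l) this
        _ = (1 - δ) * ((1 - δ) * D) := by
            simp only [← Finset.sum_mul, ← Finset.mul_sum, hq1, mul_assoc]
    rw [norm_smul, Real.norm_of_nonneg hpos.le] at hle
    exact le_of_mul_le_mul_left hle hpos

end Stochastic

section Limit

variable {a : Matrix ι ι ℝ} (ha : ∀ i j, 0 ≤ a i j)
include ha

/-- The states of a consensus protocol stay in every ball that contains the initial states. -/
theorem norm_act_transition_le {z : ι → E} {D t : ℝ} (ht : 0 ≤ t) (hD : ∀ j, ‖z j‖ ≤ D) (i : ι) :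
    ‖act (transition a t) z i‖ ≤ D := by
  simpa using norm_act_sub_le (w := (0 : E)) (z := z) (D := D) (transition_nonneg ha ht)
    (transition_row_sum a t) (by simpa using hD) i

/-- If every vertex is reached from `r`, then `exp (-L)` contracts the diameter of the set of
states by a fixed factor, and the states approach each other. -/
theorem tendsto_act_transition_sub {r : ι}
    (hr : ∀ i, Relation.ReflTransGen (fun j i => a i j ≠ 0) r i) (z : ι → E) (i j : ι) :
    Tendsto (fun t => act (transition a t) z i - act (transition a t) z j) atTop (𝓝 0) := by
  obtain ⟨δ, hδ0, hδ⟩ : ∃ δ > 0, ∀ i, δ ≤ transition a 1 i r := by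
    obtain ⟨i₀, -, hi₀⟩ := Finset.exists_min_image Finset.univ (fun i => transition a 1 i r)
      ⟨r, Finset.mem_univ r⟩
    exact ⟨_, transition_pos ha one_pos (hr i₀), fun i => hi₀ i (Finset.mem_univ i)⟩
  have hδ1 : δ ≤ 1 := (hδ i).trans <| (Finset.single_le_sum
    (fun k _ => transition_nonneg ha zero_le_one i k) (Finset.mem_univ r)).trans
      (transition_row_sum a 1 i).le
  set D : ℝ := ∑ i, ∑ j, ‖z i - z j‖ with hDdef
  have hD : ∀ i j, ‖z i - z j‖ ≤ D := fun i j =>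
    (Finset.single_le_sum (f := fun j => ‖z i - z j‖) (fun _ _ => norm_nonneg _)
      (Finset.mem_univ j)).trans
    (Finset.single_le_sum (f := fun i => ∑ j, ‖z i - z j‖)
      (fun _ _ => Finset.sum_nonneg fun _ _ => norm_nonneg _) (Finset.mem_univ i))
  have hstep : ∀ (k : ℕ) (i j : ι), ‖act (transition a k) z i - act (transition a k) z j‖ ≤
      (1 - δ) ^ k * D := fun k => by
    induction k with
    | zero => simpa [transition_zero, one_act] using hD
    | succ k ih =>
      intro i j
      rw [Nat.cast_succ, add_comm (k : ℝ) 1, transition_add, ← act_act, pow_succ', mul_assoc]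
      exact norm_act_sub_act_le (transition_nonneg ha zero_le_one) (transition_row_sum a 1) hδ ih
        i j
  rw [Metric.tendsto_atTop]
  intro ε hε
  have hlim : Tendsto (fun k : ℕ => (1 - δ) ^ k * D) atTop (𝓝 0) := by
    simpa using (tendsto_pow_atTop_nhds_zero_of_lt_one (sub_nonneg.2 hδ1)
      (by linarith)).mul_const D
  obtain ⟨k, hk⟩ := (hlim.eventually (gt_mem_nhds hε)).exists
  refine ⟨k, fun t ht => ?_⟩
  have ht' : 0 ≤ t - k := sub_nonneg.2 ht
  rw [dist_zero_right]
  have h := norm_act_sub_act_le (transition_nonneg ha ht') (transition_row_sum a (t - k))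
    (fun i => transition_nonneg ha ht' i r) (hstep k) i j
  rw [act_act, ← transition_add, sub_add_cancel, sub_zero, one_mul] at h
  exact h.trans_lt hk

/-- States that approach each other converge: from time `T` on, all states stay in the convex hull
of the states at time `T`. -/
theorem exists_tendsto_act_transition [CompleteSpace E] [Nonempty ι] {z : ι → E}
    (h : ∀ i j, Tendsto (fun t => act (transition a t) z i - act (transition a t) z j) atTop
      (𝓝 0)) :
    ∃ c, ∀ i, Tendsto (fun t => act (transition a t) z i) atTop (𝓝 c) := by
  obtain ⟨i₀⟩ := ‹Nonempty ι›
  have hcauchy : Cauchy (map (fun t => act (transition a t) z i₀) atTop) := by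
    rw [Metric.cauchy_iff]
    refine ⟨inferInstance, fun ε hε => ?_⟩
    have hev : ∀ᶠ t in atTop, ∀ j,
        ‖act (transition a t) z j - act (transition a t) z i₀‖ < ε / 3 :=
      eventually_all.2 fun j => by
        have := (h j i₀).norm
        rw [norm_zero] at this
        exact this.eventually (gt_mem_nhds (by positivity))
    obtain ⟨T, hT⟩ := hev.exists
    have hball : ∀ t, T ≤ t →
        ‖act (transition a t) z i₀ - act (transition a T) z i₀‖ ≤ ε / 3 := fun t ht => by
      have ht' : 0 ≤ t - T := sub_nonneg.2 ht
      have := norm_act_sub_le (transition_nonneg ha ht') (transition_row_sum a (t - T))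
        (fun j => (hT j).le) i₀
      rwa [act_act, ← transition_add, sub_add_cancel] at this
    refine ⟨_, image_mem_map (Ici_mem_atTop T), ?_⟩
    rintro _ ⟨s, hs, rfl⟩ _ ⟨t, ht, rfl⟩
    have h1 := hball s hs
    have h2 := hball t ht
    rw [← dist_eq_norm] at h1 h2
    rw [dist_comm] at h2
    linarith [dist_triangle (act (transition a s) z i₀) (act (transition a T) z i₀)
      (act (transition a t) z i₀)]
  obtain ⟨c, hc⟩ := CompleteSpace.complete hcauchy
  refine ⟨c, fun i => ?_⟩
  have := (h i i₀).add (show Tendsto (fun t => act (transition a t) z i₀) atTop (𝓝 c) from hc)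
  simpa using this

end Limit

end Consensus

/-! ### Directed spanning trees -/

section Digraph

variable {V : Type*}

/-- If any two elements of a finite nonempty type have a common ancestor, then some element is an
ancestor of all. -/
theorem exists_forall_reflTransGen [Finite V] [Nonempty V] {R : V → V → Prop}
    (h : ∀ i j, ∃ k, Relation.ReflTransGen R k i ∧ Relation.ReflTransGen R k j) :
    ∃ r, ∀ i, Relation.ReflTransGen R r i := by
  classical
  have := Fintype.ofFinite V
  have key : ∀ s : Finset V, ∃ r, ∀ i ∈ s, Relation.ReflTransGen R r i := fun s => by
    induction s using Finset.induction_on with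
    | empty => exact ⟨Classical.arbitrary V, by simp⟩
    | insert v s _ ih =>
      obtain ⟨r, hr⟩ := ih
      obtain ⟨k, hk, hkr⟩ := h v r
      refine ⟨k, fun i hi => ?_⟩
      rcases Finset.mem_insert.1 hi with rfl | hi
      · exact hk
      · exact hkr.trans (hr i hi)
  obtain ⟨r, hr⟩ := key Finset.univ
  exact ⟨r, fun i => hr i (Finset.mem_univ i)⟩

/-- `ReachIn R r k j` means that some directed walk with `k` edges leads from `r` to `j`. -/
def ReachIn (R : V → V → Prop) (r : V) : ℕ → V → Prop
  | 0, j => j = r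
  | k + 1, j => ∃ i, ReachIn R r k i ∧ R i j

theorem exists_reachIn {R : V → V → Prop} {r j : V} (h : Relation.ReflTransGen R r j) :
    ∃ k, ReachIn R r k j := by
  induction h with
  | refl => exact ⟨0, rfl⟩
  | tail _ hij ih => exact ih.imp' Nat.succ fun k hk => ⟨_, hk, hij⟩

/-- For the converse direction, every vertex other than the root chooses as its parent the last but
one vertex of a shortest path from the root; the edges from these parents form the tree. -/
theorem hasDirectedSpanningTree_iff (G : Digraph V) :
    HasDirectedSpanningTree G ↔ ∃ r, ∀ j, Relation.ReflTransGen G.Adj r j := by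
  classical
  constructor
  · rintro ⟨T, hTG, r, hT⟩
    exact ⟨r, fun j =>
      Relation.ReflTransGen.mono (fun i j hij => hTG hij) _ _ (hT.path_from_root j)⟩
  · rintro ⟨r, hr⟩
    have hex : ∀ j, ∃ k, ReachIn G.Adj r k j := fun j => exists_reachIn (hr j)
    have hpar : ∀ j, j ≠ r → ∃ i, G.Adj i j ∧ Nat.find (hex i) < Nat.find (hex j) := by
      intro j hj
      have hspec := Nat.find_spec (hex j)
      cases hk : Nat.find (hex j) with
      | zero => rw [hk] at hspec; exact absurd hspec hj
      | succ k =>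
        rw [hk] at hspec
        obtain ⟨i, hi, hij⟩ := hspec
        exact ⟨i, hij, Nat.lt_succ_of_le (Nat.find_min' (hex i) hi)⟩
    choose! par hadj hlt using hpar
    refine ⟨⟨fun i j => j ≠ r ∧ i = par j⟩, ?_, r, ?_, ?_, ?_⟩
    · rintro i j ⟨hj, rfl⟩
      exact hadj j hj
    · rintro i ⟨h, -⟩
      exact h rfl
    · exact fun j hj => ⟨par j, ⟨hj, rfl⟩, fun i hi => hi.2⟩
    · intro j
      induction hd : Nat.find (hex j) using Nat.strong_induction_on generalizing j with
      | _ d ih =>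
        by_cases hj : j = r
        · rw [hj]
        · exact (ih _ (hd ▸ hlt j hj) (par j) rfl).tail ⟨hj, rfl⟩

theorem WeightedDigraph.a_nonneg {n : ℕ} (G : WeightedDigraph n) (i j : Fin n) : 0 ≤ G.a i j := by
  by_cases h : G.Adj j i
  · exact (G.weight_pos i j h).le
  · exact (G.weight_eq_zero i j h).ge

theorem WeightedDigraph.adj_eq {n : ℕ} (G : WeightedDigraph n) :
    G.Adj = fun j i => G.a i j ≠ 0 := by
  funext j i
  exact propext ⟨fun h => (G.weight_pos i j h).ne', fun h => by
    by_contra h'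
    exact h (G.weight_eq_zero i j h')⟩

end Digraph

/-! ### Exponential and logarithm of quaternions -/

/-- `vec4` as a continuous linear equivalence. -/
def vec4CLE : ℍ[ℝ] ≃L[ℝ] (Fin 4 → ℝ) :=
  LinearEquiv.toContinuousLinearEquiv
    { toFun := vec4
      invFun := fun v => ⟨v 0, v 1, v 2, v 3⟩
      left_inv := fun _ => rfl
      right_inv := fun v => by ext i; fin_cases i <;> rfl
      map_add' := fun p q => by ext i; fin_cases i <;> rfl
      map_smul' := fun c p => by ext i; fin_cases i <;> rfl }

theorem vec4CLE_apply (q : ℍ[ℝ]) : vec4CLE q = vec4 q := rfl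

/-- `vec3` as a continuous linear map. -/
def vec3CLM : ℍ[ℝ] →L[ℝ] (Fin 3 → ℝ) :=
  LinearMap.toContinuousLinearMap
    { toFun := vec3
      map_add' := fun p q => by ext i; fin_cases i <;> rfl
      map_smul' := fun c p => by ext i; fin_cases i <;> rfl }

theorem vec3CLM_apply (q : ℍ[ℝ]) : vec3CLM q = vec3 q := rfl

/-- `pureOfVec` as a continuous linear map. -/
def pureOfVecCLM : (Fin 3 → ℝ) →L[ℝ] ℍ[ℝ] :=
  LinearMap.toContinuousLinearMap
    { toFun := pureOfVec
      map_add' := fun p q => by ext <;> first | rfl | exact (add_zero (0 : ℝ)).symm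
      map_smul' := fun c p => by ext <;> first | rfl | exact (mul_zero c).symm }

theorem pureOfVecCLM_apply (v : Fin 3 → ℝ) : pureOfVecCLM v = pureOfVec v := rfl

theorem vec3_pureOfVec (v : Fin 3 → ℝ) : vec3 (pureOfVec v) = v := by
  ext i; fin_cases i <;> rfl

theorem pureOfVec_vec3 {q : ℍ[ℝ]} (hq : q.re = 0) : pureOfVec (vec3 q) = q := by
  ext <;> simp [pureOfVec, vec3, hq]

theorem norm_im_sq {r : ℍ[ℝ]} (hr : ‖r‖ = 1) : ‖r.im‖ ^ 2 = 1 - r.re ^ 2 := by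
  have h1 := Quaternion.normSq_eq_norm_mul_self r
  have h2 := Quaternion.normSq_eq_norm_mul_self r.im
  rw [hr, Quaternion.normSq_def'] at h1
  rw [Quaternion.normSq_def'] at h2
  simp only [Quaternion.re_im, Quaternion.imI_im, Quaternion.imJ_im, Quaternion.imK_im] at h2
  nlinarith

/-- The only real unit quaternions are `1` and `-1`. -/
theorem eq_one_of_im_eq_zero {r : ℍ[ℝ]} (hr : ‖r‖ = 1) (h1 : r ≠ -1) (him : r.im = 0) :
    r = 1 := by
  have h := norm_im_sq hr
  rw [him, norm_zero] at h
  have hre : r = (r.re : ℍ[ℝ]) := by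
    conv_lhs => rw [← Quaternion.re_add_im r, him, add_zero]
  rcases sq_eq_sq_iff_eq_or_eq_neg.1 (show r.re ^ 2 = 1 ^ 2 by linarith) with h' | h'
  · rw [hre, h']; rfl
  · exact absurd (by rw [hre, h']; simp) h1

theorem neg_one_le_re_and_re_le_one {r : ℍ[ℝ]} (hr : ‖r‖ = 1) : -1 ≤ r.re ∧ r.re ≤ 1 := by
  have := norm_im_sq hr
  exact abs_le.1 (abs_le_one_iff_mul_self_le_one.2 (by nlinarith [sq_nonneg ‖r.im‖]))

theorem neg_one_lt_re {r : ℍ[ℝ]} (hr : ‖r‖ = 1) (h1 : r ≠ -1) : -1 < r.re := by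
  refine lt_of_le_of_ne (neg_one_le_re_and_re_le_one hr).1 fun h => h1 ?_
  have h2 := norm_im_sq hr
  rw [← h] at h2
  have h3 : r.im = 0 := by simpa using h2
  rw [← Quaternion.re_add_im r, h3, ← h]
  simp

theorem quatLog_re (r : ℍ[ℝ]) : (quatLog r).re = 0 := by simp [quatLog]

theorem quatLog_one : quatLog 1 = 0 := by simp [quatLog]

theorem norm_quatLog_le (r : ℍ[ℝ]) : ‖quatLog r‖ ≤ Real.arccos r.re := by
  by_cases h : r.im = 0
  · simp [quatLog, h, Real.arccos_nonneg]
  · have h' : ‖r.im‖ ≠ 0 := norm_ne_zero_iff.2 h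
    rw [quatLog, norm_smul, Real.norm_of_nonneg (div_nonneg (Real.arccos_nonneg _) (norm_nonneg _)),
      div_mul_cancel₀ _ h']

theorem norm_quatLog_lt {r : ℍ[ℝ]} (hr : ‖r‖ = 1) (h1 : r ≠ -1) : ‖quatLog r‖ < Real.pi := by
  refine (norm_quatLog_le r).trans_lt (lt_of_le_of_ne (Real.arccos_le_pi _) fun h => ?_)
  exact (Real.arccos_eq_pi.1 h).not_gt (neg_one_lt_re hr h1)

theorem exp_quatLog {r : ℍ[ℝ]} (hr : ‖r‖ = 1) (h1 : r ≠ -1) :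
    NormedSpace.exp (quatLog r) = r := by
  by_cases h : r.im = 0
  · rw [eq_one_of_im_eq_zero hr h1 h, quatLog_one, NormedSpace.exp_zero]
  · have h' : 0 < ‖r.im‖ := norm_pos_iff.2 h
    obtain ⟨hl, hu⟩ := neg_one_le_re_and_re_le_one hr
    have hn : ‖quatLog r‖ = Real.arccos r.re := by
      rw [quatLog, norm_smul,
        Real.norm_of_nonneg (div_nonneg (Real.arccos_nonneg _) (norm_nonneg _)),
        div_mul_cancel₀ _ h'.ne']
    have hs : Real.sin (Real.arccos r.re) = ‖r.im‖ := by
      rw [Real.sin_arccos, ← norm_im_sq hr, Real.sqrt_sq h'.le]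
    have ha : Real.arccos r.re ≠ 0 := fun h0 => by
      rw [h0, Real.sin_zero] at hs
      exact h'.ne hs
    rw [Quaternion.exp_of_re_eq_zero _ (quatLog_re r), hn, Real.cos_arccos hl hu, hs, quatLog,
      smul_smul, div_mul_div_cancel₀ ha, div_self h'.ne', one_smul, Quaternion.re_add_im]

theorem norm_exp_of_re_eq_zero {q : ℍ[ℝ]} (hq : q.re = 0) : ‖NormedSpace.exp q‖ = 1 := by
  rw [Quaternion.norm_exp, hq, NormedSpace.exp_zero, norm_one]

theorem re_exp_of_re_eq_zero {q : ℍ[ℝ]} (hq : q.re = 0) :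
    (NormedSpace.exp q).re = Real.cos ‖q‖ := by
  rw [Quaternion.exp_of_re_eq_zero q hq]
  simp [hq]

theorem quatLog_exp {q : ℍ[ℝ]} (hq : q.re = 0) (hπ : ‖q‖ < Real.pi) :
    quatLog (NormedSpace.exp q) = q := by
  by_cases h : q = 0
  · rw [h, NormedSpace.exp_zero, quatLog_one]
  have hpos : 0 < ‖q‖ := norm_pos_iff.2 h
  have hsin := Real.sin_pos_of_pos_of_lt_pi hpos hπ
  have him : (NormedSpace.exp q).im = (Real.sin ‖q‖ / ‖q‖) • q := by
    rw [Quaternion.exp_of_re_eq_zero q hq]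
    ext <;> simp [hq]
  have hn : ‖(Real.sin ‖q‖ / ‖q‖) • q‖ = Real.sin ‖q‖ := by
    rw [norm_smul, Real.norm_of_nonneg (by positivity), div_mul_cancel₀ _ hpos.ne']
  rw [quatLog, re_exp_of_re_eq_zero hq, him, hn, Real.arccos_cos hpos.le hπ.le, smul_smul,
    div_mul_div_cancel₀ hsin.ne', div_self hpos.ne', one_smul]

theorem exp_ne_neg_one {q : ℍ[ℝ]} (hq : q.re = 0) (hπ : ‖q‖ < Real.pi) :
    NormedSpace.exp q ≠ -1 := fun h => by
  have h1 := quatLog_exp hq hπ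
  have h2 : q = 0 := by rw [← h1, h]; simp [quatLog]
  rw [h2, NormedSpace.exp_zero] at h
  have := congrArg (fun q : ℍ[ℝ] => q.re) h
  norm_num at this

/-- At `r = 1` the axis of rotation is not determined, but the angle tends to `0`. -/
theorem continuousAt_quatLog {r : ℍ[ℝ]} (hr : ‖r‖ = 1) (h1 : r ≠ -1) :
    ContinuousAt quatLog r := by
  by_cases h : r.im = 0
  · rw [eq_one_of_im_eq_zero hr h1 h, ContinuousAt, quatLog_one]
    refine squeeze_zero_norm norm_quatLog_le ?_
    have : Continuous fun r : ℍ[ℝ] => Real.arccos r.re :=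
      Real.continuous_arccos.comp Quaternion.continuous_re
    simpa using this.tendsto 1
  · have hdiv : ContinuousAt (fun r : ℍ[ℝ] => Real.arccos r.re / ‖r.im‖) r :=
      ContinuousAt.div (Real.continuous_arccos.comp Quaternion.continuous_re).continuousAt
        Quaternion.continuous_im.norm.continuousAt (norm_ne_zero_iff.2 h)
    exact hdiv.smul Quaternion.continuous_im.continuousAt

/-! ### The exponential as an immersion -/

theorem hasStrictFDerivAt_vec4_exp (v : Fin 3 → ℝ) :
    HasStrictFDerivAt (fun v : Fin 3 → ℝ => vec4 (NormedSpace.exp (pureOfVec v)))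
      (fderiv ℝ (fun v : Fin 3 → ℝ => vec4 (NormedSpace.exp (pureOfVec v))) v) v := by
  have hexp : ContDiff ℝ 1 (NormedSpace.exp : ℍ[ℝ] → ℍ[ℝ]) :=
    contDiff_iff_contDiffAt.2 fun q => (NormedSpace.exp_analytic (𝕂 := ℝ) q).contDiffAt
  have h : ContDiff ℝ 1 (fun v : Fin 3 → ℝ => vec4 (NormedSpace.exp (pureOfVec v))) :=
    vec4CLE.contDiff.comp (hexp.comp pureOfVecCLM.contDiff)
  exact h.contDiffAt.hasStrictFDerivAt one_ne_zero

theorem Q_mulVec (r : ℍ[ℝ]) (w : Fin 3 → ℝ) :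
    Q r *ᵥ w = fderiv ℝ (fun v : Fin 3 → ℝ => vec4 (NormedSpace.exp (pureOfVec v)))
      (vec3 (quatLog r)) w := by
  rw [Q, ← Matrix.toLin'_apply, Matrix.toLin'_toMatrix']
  rfl

/-- In the ball of radius `π` the derivative of the exponential is injective: the real part
`cos ‖q‖` detects the radial component of a direction, and the imaginary part
`(sin ‖q‖ / ‖q‖) q` the remaining ones. -/
theorem eq_zero_of_hasDerivAt_exp_zero {q k : ℍ[ℝ]} (hq : q.re = 0) (hk : k.re = 0)
    (hπ : ‖q‖ < Real.pi)
    (h : HasDerivAt (fun s : ℝ => NormedSpace.exp (q + s • k)) 0 0) : k = 0 := by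
  have hlin : HasDerivAt (fun s : ℝ => q + s • k) k 0 := by
    simpa using ((hasDerivAt_id (0 : ℝ)).smul_const k).const_add q
  by_cases hq0 : q = 0
  · have h0 : HasFDerivAt (NormedSpace.exp : ℍ[ℝ] → ℍ[ℝ]) (1 : ℍ[ℝ] →L[ℝ] ℍ[ℝ])
        (q + (0 : ℝ) • k) := by
      rw [hq0, zero_smul, add_zero]
      exact hasFDerivAt_exp_zero
    exact (h0.comp_hasDerivAt (0 : ℝ) hlin).unique h
  have hpos : 0 < ‖q‖ := norm_pos_iff.2 hq0
  have hsin := Real.sin_pos_of_pos_of_lt_pi hpos hπ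
  have hre : ∀ s : ℝ, (q + s • k).re = 0 := fun s => by simp [hq, hk]
  obtain ⟨N', hN⟩ : ∃ N', HasDerivAt (fun s : ℝ => ‖q + s • k‖) N' 0 :=
    ⟨_, (hlin.differentiableAt.norm ℝ (by simpa using hq0)).hasDerivAt⟩
  have hcos : HasDerivAt (fun s : ℝ => Real.cos ‖q + s • k‖) 0 0 := by
    have h1 := (vec4CLE : ℍ[ℝ] →L[ℝ] (Fin 4 → ℝ)).hasFDerivAt.comp_hasDerivAt (0 : ℝ) h
    have h2 := hasDerivAt_pi.1 h1 0
    have h3 : (fun s : ℝ => Real.cos ‖q + s • k‖) =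
        fun s : ℝ => vec4 (NormedSpace.exp (q + s • k)) 0 := by
      funext s
      exact (re_exp_of_re_eq_zero (hre s)).symm
    rw [h3]
    rw [map_zero] at h2
    exact h2
  have hN0 : N' = 0 := by
    have h1 := hcos.unique hN.cos
    rw [zero_smul, add_zero] at h1
    exact (mul_eq_zero.1 h1.symm).resolve_left (neg_ne_zero.2 hsin.ne')
  rw [hN0] at hN
  have hc : HasDerivAt (fun s : ℝ => Real.sin ‖q + s • k‖ / ‖q + s • k‖) 0 0 := by
    simpa using hN.sin.fun_div hN (by simpa using hpos.ne')
  have him : HasDerivAt (fun s : ℝ => NormedSpace.exp (q + s • k))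
      ((Real.sin ‖q‖ / ‖q‖) • k) 0 := by
    have hcos' : HasDerivAt (fun s : ℝ => ((Real.cos ‖q + s • k‖ : ℝ) : ℍ[ℝ])) 0 0 := by
      have := hcos.smul_const (1 : ℍ[ℝ])
      rw [zero_smul] at this
      refine this.congr_of_eventuallyEq (Eventually.of_forall fun s => ?_)
      exact Algebra.algebraMap_eq_smul_one (A := ℍ[ℝ]) (Real.cos ‖q + s • k‖)
    have h1 := hcos'.add (hc.smul hlin)
    simp only [zero_smul, add_zero, zero_add] at h1
    refine h1.congr_of_eventuallyEq (Eventually.of_forall fun s => ?_)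
    exact Quaternion.exp_of_re_eq_zero _ (hre s)
  have := him.unique h
  exact (smul_eq_zero.1 this).resolve_left (div_pos hsin hpos).ne'

theorem Q_mulVec_eq_zero {r : ℍ[ℝ]} (hr : ‖r‖ = 1) (h1 : r ≠ -1) {w : Fin 3 → ℝ}
    (hw : Q r *ᵥ w = 0) : w = 0 := by
  set v := vec3 (quatLog r) with hv
  have hd : HasDerivAt (fun s : ℝ => v + s • w) w 0 := by
    simpa using ((hasDerivAt_id (0 : ℝ)).smul_const w).const_add v
  have hs : HasFDerivAt (fun v : Fin 3 → ℝ => vec4 (NormedSpace.exp (pureOfVec v)))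
      (fderiv ℝ (fun v : Fin 3 → ℝ => vec4 (NormedSpace.exp (pureOfVec v))) v)
      (v + (0 : ℝ) • w) := by
    rw [zero_smul, add_zero]
    exact (hasStrictFDerivAt_vec4_exp v).hasFDerivAt
  have h2 := hs.comp_hasDerivAt (0 : ℝ) hd
  rw [← Q_mulVec, hw] at h2
  have h3 := (vec4CLE.symm : (Fin 4 → ℝ) →L[ℝ] ℍ[ℝ]).hasFDerivAt.comp_hasDerivAt (0 : ℝ) h2
  have h4 : HasDerivAt (fun s : ℝ => NormedSpace.exp (quatLog r + s • pureOfVec w)) 0 0 := by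
    rw [map_zero] at h3
    refine h3.congr_of_eventuallyEq (Eventually.of_forall fun s => ?_)
    have : pureOfVec (v + s • w) = quatLog r + s • pureOfVec w := by
      rw [← pureOfVecCLM_apply, map_add, map_smul, pureOfVecCLM_apply, pureOfVecCLM_apply, hv,
        pureOfVec_vec3 (quatLog_re r)]
    change _ = vec4CLE.symm (vec4CLE _)
    rw [this, ContinuousLinearEquiv.symm_apply_apply]
  have h5 := eq_zero_of_hasDerivAt_exp_zero (quatLog_re r) rfl (norm_quatLog_lt hr h1) h4
  rw [← vec3_pureOfVec w, h5, ← vec3CLM_apply, map_zero]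

/-- `Q` turns the velocity of a logarithm into the velocity of the rotation. -/
theorem hasDerivWithinAt_vec4_exp {v : ℝ → ℍ[ℝ]} {v' : ℍ[ℝ]} {S : Set ℝ} {t : ℝ}
    (hv : ∀ s, (v s).re = 0) (hπ : ‖v t‖ < Real.pi) (h : HasDerivWithinAt v v' S t) :
    HasDerivWithinAt (fun s => vec4 (NormedSpace.exp (v s)))
      (Q (NormedSpace.exp (v t)) *ᵥ vec3 v') S t := by
  rw [Q_mulVec, quatLog_exp (hv t) hπ]
  have h1 := (hasStrictFDerivAt_vec4_exp (vec3 (v t))).hasFDerivAt.comp_hasDerivWithinAt t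
    (vec3CLM.hasFDerivAt.comp_hasDerivWithinAt t h)
  refine h1.congr (fun s _ => ?_) ?_ <;>
  simp only [Function.comp_apply, vec3CLM_apply, pureOfVec_vec3 (hv _)]

/-- If a curve of unit quaternions moves in the direction `Q(r) w`, then its logarithm moves in the
direction `w`. The logarithm need not be differentiated: near `log r`, a left inverse of the
derivative of `exp` makes `exp` locally invertible by the inverse function theorem, and by
continuity the logarithm coincides with this local inverse along the curve. -/
theorem hasDerivWithinAt_quatLog {r : ℝ → ℍ[ℝ]} {w : Fin 3 → ℝ} {S : Set ℝ} {t : ℝ} (ht : t ∈ S)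
    (hr : ∀ s ∈ S, ‖r s‖ = 1) (h1 : r t ≠ -1)
    (h : HasDerivWithinAt (fun s => vec4 (r s)) (Q (r t) *ᵥ w) S t) :
    HasDerivWithinAt (fun s => quatLog (r s)) (pureOfVec w) S t := by
  set F : (Fin 3 → ℝ) → (Fin 4 → ℝ) := fun v => vec4 (NormedSpace.exp (pureOfVec v)) with hF
  set v₀ := vec3 (quatLog (r t)) with hv₀
  set D := fderiv ℝ F v₀ with hD
  have hQ : ∀ u, Q (r t) *ᵥ u = D u := fun u => Q_mulVec (r t) u
  -- `exp` composed with `A` has the identity as its derivative at `log r`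
  obtain ⟨A, hA⟩ := D.toLinearMap.exists_leftInverse_of_injective
    (LinearMap.ker_eq_bot'.2 fun u hu => Q_mulVec_eq_zero (hr t ht) h1 ((hQ u).trans hu))
  have hAD : ∀ u, A (D u) = u := fun u => LinearMap.congr_fun hA u
  have hf : HasStrictFDerivAt (fun v => A.toContinuousLinearMap (F v))
      (ContinuousLinearEquiv.refl ℝ (Fin 3 → ℝ) : (Fin 3 → ℝ) →L[ℝ] (Fin 3 → ℝ)) v₀ := by
    refine (A.toContinuousLinearMap.hasStrictFDerivAt.comp v₀
      (hasStrictFDerivAt_vec4_exp v₀)).congr_fderiv ?_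
    ext u : 1
    exact hAD u
  have hcont : ContinuousWithinAt r S t := by
    have := vec4CLE.symm.continuous.continuousAt.comp_continuousWithinAt h.continuousWithinAt
    exact this
  have hlog : Tendsto (fun s => vec3 (quatLog (r s))) (𝓝[S] t) (𝓝 v₀) :=
    (vec3CLM.continuous.continuousAt.comp_continuousWithinAt
      ((continuousAt_quatLog (hr t ht) h1).comp_continuousWithinAt hcont))
  have hFr : ∀ᶠ s in 𝓝[S] t, F (vec3 (quatLog (r s))) = vec4 (r s) := by
    have hne : ∀ᶠ s in 𝓝[S] t, r s ≠ -1 := hcont.eventually_ne h1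
    filter_upwards [hne, self_mem_nhdsWithin] with s hs hsS
    rw [hF]
    simp only
    rw [pureOfVec_vec3 (quatLog_re _), exp_quatLog (hr s hsS) hs]
  have hg := hf.to_localInverse.hasFDerivAt
  have hev : ∀ᶠ s in 𝓝[S] t, vec3 (quatLog (r s)) =
      hf.localInverse _ _ _ (A.toContinuousLinearMap (vec4 (r s))) := by
    filter_upwards [hFr, hlog.eventually hf.eventually_left_inverse] with s hs hs'
    rw [← hs, hs']
  have hAr := A.toContinuousLinearMap.hasFDerivAt.comp_hasDerivWithinAt t h
  rw [hFr.self_of_nhdsWithin ht] at hg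
  have h2 := hg.comp_hasDerivWithinAt t hAr
  have h3 : HasDerivWithinAt (fun s => vec3 (quatLog (r s))) w S t := by
    refine (h2.congr_of_eventuallyEq hev (hev.self_of_nhdsWithin ht)).congr_deriv ?_
    rw [hQ]
    exact hAD w
  have h4 := pureOfVecCLM.hasFDerivAt.comp_hasDerivWithinAt t h3
  refine h4.congr (fun s _ => ?_) ?_ <;>
  simp only [Function.comp_apply, pureOfVecCLM_apply, pureOfVec_vec3 (quatLog_re _)]

/-! ### Poses and their logarithms -/

theorem fst_mkDQ (h h' : ℍ[ℝ]) : (mkDQ h h').fst = h := by simp [mkDQ]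

theorem snd_mkDQ (h h' : ℍ[ℝ]) : (mkDQ h h').snd = h' := by simp [mkDQ]

theorem mkDQ_sub (h h' k k' : ℍ[ℝ]) : mkDQ h h' - mkDQ k k' = mkDQ (h - k) (h' - k') :=
  TrivSqZeroExt.ext (by simp [fst_mkDQ]) (by simp [snd_mkDQ])

theorem tendsto_mkDQ {α : Type*} {l : Filter α} {f g : α → ℍ[ℝ]} {h h' : ℍ[ℝ]}
    (hf : Tendsto f l (𝓝 h)) (hg : Tendsto g l (𝓝 h')) :
    Tendsto (fun a => mkDQ (f a) (g a)) l (𝓝 (mkDQ h h')) :=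
  ((TrivSqZeroExt.continuous_inl.tendsto h).comp hf).add
    ((TrivSqZeroExt.continuous_inr.tendsto h').comp hg)

theorem mem_unitDQ_iff (x : DualQuat) :
    x ∈ unitDQ ↔ ‖x.fst‖ = 1 ∧ x.fst * star x.snd + x.snd * star x.fst = 0 := by
  have h1 : x.fst * star x.fst = 1 ↔ ‖x.fst‖ = 1 := by
    rw [Quaternion.self_mul_star, Quaternion.normSq_eq_norm_mul_self, ← Quaternion.coe_one,
      Quaternion.coe_inj, ← sq, pow_eq_one_iff_of_nonneg (norm_nonneg _) two_ne_zero]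
  simp only [unitDQ, conj, Set.mem_ofPred_eq, TrivSqZeroExt.ext_iff, TrivSqZeroExt.fst_mul,
    TrivSqZeroExt.snd_mul, fst_mkDQ, snd_mkDQ, TrivSqZeroExt.fst_one, TrivSqZeroExt.snd_one,
    smul_eq_mul, MulOpposite.smul_eq_mul_unop, MulOpposite.unop_op, h1]

theorem self_mul_star_of_norm_eq_one {r : ℍ[ℝ]} (hr : ‖r‖ = 1) : r * star r = 1 := by
  rw [Quaternion.self_mul_star, Quaternion.normSq_eq_norm_mul_self, hr, one_mul,
    Quaternion.coe_one]

theorem star_mul_self_of_norm_eq_one {r : ℍ[ℝ]} (hr : ‖r‖ = 1) : star r * r = 1 := by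
  rw [Quaternion.star_mul_self, Quaternion.normSq_eq_norm_mul_self, hr, one_mul,
    Quaternion.coe_one]

/-- Half of the translation of a pose, the dual part of its logarithm. -/
def halfTrans (x : DualQuat) : ℍ[ℝ] := (1 / 2 : ℝ) • trans x

theorem halfTrans_eq (x : DualQuat) : halfTrans x = x.snd * star x.fst := by
  rw [halfTrans, trans, smul_smul]
  norm_num

theorem halfTrans_re {x : DualQuat} (hx : x ∈ unitDQ) : (halfTrans x).re = 0 := by
  have h := congrArg (fun q : ℍ[ℝ] => q.re) ((mem_unitDQ_iff x).1 hx).2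
  have h2 : x.fst * star x.snd = star (x.snd * star x.fst) := by rw [star_mul, star_star]
  rw [h2] at h
  simp only [Quaternion.re_add, Quaternion.re_star, Quaternion.re_zero] at h
  rw [halfTrans_eq]
  linarith

theorem halfTrans_mul_fst {x : DualQuat} (hx : x ∈ unitDQ) : halfTrans x * x.fst = x.snd := by
  rw [halfTrans_eq, mul_assoc, star_mul_self_of_norm_eq_one ((mem_unitDQ_iff x).1 hx).1, mul_one]

theorem norm_rot {x : DualQuat} (hx : x ∈ unitDQ) : ‖rot x‖ = 1 := ((mem_unitDQ_iff x).1 hx).1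

theorem logDQ_eq (x : DualQuat) : logDQ x = mkDQ (quatLog (rot x)) (halfTrans x) := rfl

/-- The pose with the logarithm `v + ε w`. -/
def poseExp (v w : ℍ[ℝ]) : DualQuat := mkDQ (NormedSpace.exp v) (w * NormedSpace.exp v)

theorem rot_poseExp (v w : ℍ[ℝ]) : rot (poseExp v w) = NormedSpace.exp v := fst_mkDQ _ _

theorem snd_poseExp (v w : ℍ[ℝ]) : (poseExp v w).snd = w * NormedSpace.exp v := snd_mkDQ _ _

theorem poseExp_mem_unitDQ {v w : ℍ[ℝ]} (hv : v.re = 0) (hw : w.re = 0) :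
    poseExp v w ∈ unitDQ := by
  have h := norm_exp_of_re_eq_zero hv
  rw [mem_unitDQ_iff, poseExp, fst_mkDQ, snd_mkDQ]
  refine ⟨h, ?_⟩
  rw [star_mul, ← mul_assoc, self_mul_star_of_norm_eq_one h, one_mul, mul_assoc,
    self_mul_star_of_norm_eq_one h, mul_one]
  ext <;> simp [hw]

theorem halfTrans_poseExp {v w : ℍ[ℝ]} (hv : v.re = 0) : halfTrans (poseExp v w) = w := by
  rw [halfTrans_eq, poseExp, fst_mkDQ, snd_mkDQ, mul_assoc,
    self_mul_star_of_norm_eq_one (norm_exp_of_re_eq_zero hv), mul_one]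

theorem poseExp_mem_logDomain {v w : ℍ[ℝ]} (hv : v.re = 0) (hw : w.re = 0)
    (hπ : ‖v‖ < Real.pi) : poseExp v w ∈ logDomain :=
  ⟨poseExp_mem_unitDQ hv hw, by rw [rot_poseExp]; exact exp_ne_neg_one hv hπ⟩

theorem poseExp_log {x : DualQuat} (hx : x ∈ logDomain) :
    poseExp (quatLog (rot x)) (halfTrans x) = x := by
  rw [poseExp, exp_quatLog (norm_rot hx.1) hx.2, rot, halfTrans_mul_fst hx.1]
  exact TrivSqZeroExt.inl_fst_add_inr_snd_eq x

/-! ### The kinematics in logarithmic coordinates -/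

theorem hamPlus4_mulVec (h k : ℍ[ℝ]) : hamPlus4 h *ᵥ vec4 k = vec4 (h * k) := by
  ext i
  fin_cases i <;>
  simp [hamPlus4, vec4, Matrix.mulVec, dotProduct, Fin.sum_univ_four] <;> ring

theorem hamMinus4_mulVec (h k : ℍ[ℝ]) : hamMinus4 h *ᵥ vec4 k = vec4 (k * h) := by
  ext i
  fin_cases i <;>
  simp [hamMinus4, vec4, Matrix.mulVec, dotProduct, Fin.sum_univ_four] <;> ring

theorem Qp_mulVec (v : Fin 3 → ℝ) : Qp *ᵥ v = vec4 (pureOfVec v) := by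
  ext i
  fin_cases i <;> simp [Qp, vec4, pureOfVec, Matrix.mulVec, dotProduct, Fin.sum_univ_three]

theorem Q8_mulVec (x : DualQuat) (u w : Fin 3 → ℝ) :
    Q8 x *ᵥ Sum.elim u w = Sum.elim (Q (rot x) *ᵥ u)
      (vec4 (halfTrans x * vec4CLE.symm (Q (rot x) *ᵥ u) + pureOfVec w * rot x)) := by
  have h1 : hamPlus4 (trans x) *ᵥ (Q (rot x) *ᵥ u) =
      vec4 (trans x * vec4CLE.symm (Q (rot x) *ᵥ u)) := by
    rw [← hamPlus4_mulVec, ← vec4CLE_apply, ContinuousLinearEquiv.apply_symm_apply]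
  rw [Q8, Matrix.fromBlocks_mulVec]
  simp only [Sum.elim_comp_inl, Sum.elim_comp_inr, Matrix.zero_mulVec, add_zero]
  rw [Matrix.smul_mulVec, ← Matrix.mulVec_mulVec, ← Matrix.mulVec_mulVec, Qp_mulVec,
    hamMinus4_mulVec, h1, ← vec4CLE_apply, ← vec4CLE_apply, ← vec4CLE_apply, ← map_smul,
    ← map_add, halfTrans, smul_mul_assoc]

theorem hasDerivWithinAt_vec8_iff {x : ℝ → DualQuat} {u w : Fin 3 → ℝ} {S : Set ℝ} {t : ℝ} :
    HasDerivWithinAt (fun s => vec8 (x s)) (Q8 (x t) *ᵥ Sum.elim u w) S t ↔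
      HasDerivWithinAt (fun s => vec4 (rot (x s))) (Q (rot (x t)) *ᵥ u) S t ∧
      HasDerivWithinAt (fun s => (x s).snd) (halfTrans (x t) *
        vec4CLE.symm (Q (rot (x t)) *ᵥ u) + pureOfVec w * rot (x t)) S t := by
  have h : ∀ q' : ℍ[ℝ], HasDerivWithinAt (fun s => (x s).snd) q' S t ↔
      HasDerivWithinAt (fun s => vec4 (x s).snd) (vec4 q') S t := fun q' =>
    ⟨fun h => vec4CLE.hasFDerivAt.comp_hasDerivWithinAt t h, fun h => by
      exact vec4CLE.symm.hasFDerivAt.comp_hasDerivWithinAt t h⟩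
  rw [h, Q8_mulVec, hasDerivWithinAt_pi, hasDerivWithinAt_pi, hasDerivWithinAt_pi, Sum.forall]
  rfl

/-- If `p r` moves with velocity `p r' + w r`, where `r` is a curve of unit quaternions, then `p`
moves with velocity `w`. -/
theorem hasDerivWithinAt_mul_star {r s : ℝ → ℍ[ℝ]} {r' w : ℍ[ℝ]} {S : Set ℝ} {t : ℝ}
    (hS : UniqueDiffWithinAt ℝ S t) (ht : t ∈ S) (hr : ∀ u ∈ S, ‖r u‖ = 1)
    (h1 : HasDerivWithinAt r r' S t)
    (h2 : HasDerivWithinAt s (s t * star (r t) * r' + w * r t) S t) :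
    HasDerivWithinAt (fun u => s u * star (r u)) w S t := by
  have : StarModule ℝ ℍ[ℝ] := ⟨fun c q => by ext <;> simp⟩
  -- the velocity of a unit quaternion is tangent to the unit sphere
  have htan : r' * star (r t) + r t * star r' = 0 := by
    have hm : HasDerivWithinAt (fun u => r u * star (r u)) (r' * star (r t) + r t * star r') S t :=
      h1.mul h1.star
    refine hS.eq_deriv _ hm ?_
    exact (hasDerivWithinAt_const t S (1 : ℍ[ℝ])).congr
      (fun u hu => self_mul_star_of_norm_eq_one (hr u hu))
      (self_mul_star_of_norm_eq_one (hr t ht))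
  have hst : s t = s t * star (r t) * r t := by
    rw [mul_assoc, star_mul_self_of_norm_eq_one (hr t ht), mul_one]
  have h3 : HasDerivWithinAt (fun u => s u * star (r u))
      ((s t * star (r t) * r' + w * r t) * star (r t) + s t * star r') S t := h2.mul h1.star
  refine h3.congr_deriv ?_
  calc (s t * star (r t) * r' + w * r t) * star (r t) + s t * star r'
      = (s t * star (r t) * r' + w * r t) * star (r t) + s t * star (r t) * r t * star r' := by
        rw [← hst]
    _ = s t * star (r t) * (r' * star (r t) + r t * star r') + w * (r t * star (r t)) := by
        noncomm_ring
    _ = w := by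
        rw [htan, mul_zero, zero_add, self_mul_star_of_norm_eq_one (hr t ht), mul_one]

theorem hasDerivWithinAt_halfTrans {x : ℝ → DualQuat} {u w : Fin 3 → ℝ} {S : Set ℝ} {t : ℝ}
    (hS : UniqueDiffWithinAt ℝ S t) (ht : t ∈ S) (hx : ∀ s ∈ S, x s ∈ unitDQ)
    (h : HasDerivWithinAt (fun s => vec8 (x s)) (Q8 (x t) *ᵥ Sum.elim u w) S t) :
    HasDerivWithinAt (fun s => halfTrans (x s)) (pureOfVec w) S t := by
  obtain ⟨h1, h2⟩ := hasDerivWithinAt_vec8_iff.1 h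
  have h1' : HasDerivWithinAt (fun s => rot (x s)) (vec4CLE.symm (Q (rot (x t)) *ᵥ u)) S t :=
    vec4CLE.symm.hasFDerivAt.comp_hasDerivWithinAt t h1
  rw [halfTrans_eq] at h2
  simp only [halfTrans_eq]
  exact hasDerivWithinAt_mul_star hS ht (fun s hs => norm_rot (hx s hs)) h1' h2

variable {n : ℕ} {G : WeightedDigraph n}

theorem protocolInput_eq (x : Fin n → DualQuat) (i : Fin n) :
    protocolInput G x i = Q8 (x i) *ᵥ Sum.elim
      (vec3 (-∑ j, G.a i j • (quatLog (rot (x i)) - quatLog (rot (x j)))))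
      (vec3 (-∑ j, G.a i j • (halfTrans (x i) - halfTrans (x j)))) := by
  rw [protocolInput, ← Matrix.mulVec_neg]
  congr 1
  ext k
  rcases k with k | k <;>
  simp only [logDQ_eq, mkDQ_sub, vec6, fst_mkDQ, snd_mkDQ, Pi.neg_apply, Finset.sum_apply,
    Pi.smul_apply, Sum.elim_inl, Sum.elim_inr, ← vec3CLM_apply, map_neg, map_sum, map_smul]

theorem neg_sum_re {a : Fin n → ℝ} {z : Fin n → ℍ[ℝ]} (hz : ∀ j, (z j).re = 0) (i : Fin n) :
    (-∑ j, a j • (z i - z j)).re = 0 := by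
  have : ∀ q : ℍ[ℝ], q.re = vec4CLE q 0 := fun _ => rfl
  rw [this, map_neg, map_sum]
  simp only [Pi.neg_apply, Finset.sum_apply, map_smul, map_sub, Pi.smul_apply, Pi.sub_apply,
    ← this, hz]
  simp

namespace IsTrajectory

variable {x : ℝ → Fin n → DualQuat} (hx : IsTrajectory G x)
include hx

theorem hasDerivWithinAt_quatLog {t : ℝ} (ht : 0 ≤ t) {i : Fin n} (hi : rot (x t i) ≠ -1) :
    HasDerivWithinAt (fun s => quatLog (rot (x s i)))
      (-∑ j, G.a i j • (quatLog (rot (x t i)) - quatLog (rot (x t j)))) (Set.Ici 0) t := by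
  have h := hx.ode t ht i
  rw [protocolInput_eq, hasDerivWithinAt_vec8_iff (x := fun s => x s i)] at h
  rw [← pureOfVec_vec3 (neg_sum_re (fun j => quatLog_re (rot (x t j))) i)]
  exact RigidBody.hasDerivWithinAt_quatLog (r := fun s => rot (x s i)) ht
    (fun s hs => norm_rot (hx.unit s hs i)) hi h.1

theorem hasDerivWithinAt_halfTrans {t : ℝ} (ht : 0 ≤ t) (i : Fin n) :
    HasDerivWithinAt (fun s => halfTrans (x s i))
      (-∑ j, G.a i j • (halfTrans (x t i) - halfTrans (x t j))) (Set.Ici 0) t := by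
  have h := hx.ode t ht i
  rw [protocolInput_eq] at h
  rw [← pureOfVec_vec3 (neg_sum_re (fun j => halfTrans_re (hx.unit t ht j)) i)]
  exact RigidBody.hasDerivWithinAt_halfTrans (x := fun s => x s i)
    (uniqueDiffOn_Ici 0 t ht) ht (fun s hs => hx.unit s hs i) h

theorem halfTrans_eq {t : ℝ} (ht : 0 ≤ t) (i : Fin n) :
    halfTrans (x t i) = act (transition G.a t) (fun j => halfTrans (x 0 j)) i :=
  congrFun (eq_act_transition (z := fun t i => halfTrans (x t i)) ht
    fun _ hs i => hx.hasDerivWithinAt_halfTrans hs.1 i) i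

theorem continuousOn_rot (i : Fin n) : ContinuousOn (fun t => rot (x t i)) (Set.Ici 0) :=
  fun t ht => by
    have h := hx.ode t ht i
    rw [protocolInput_eq, hasDerivWithinAt_vec8_iff (x := fun s => x s i)] at h
    exact vec4CLE.symm.continuous.continuousAt.comp_continuousWithinAt h.1.continuousWithinAt

/-- As long as the rotations differ from `-1`, the rotation parts of the outputs solve the linear
consensus equation. -/
theorem quatLog_eq_of_forall {T : ℝ} (hT : 0 ≤ T)
    (h : ∀ t ∈ Set.Icc 0 T, ∀ i, rot (x t i) ≠ -1) (i : Fin n) :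
    quatLog (rot (x T i)) = act (transition G.a T) (fun j => quatLog (rot (x 0 j))) i :=
  congrFun (eq_act_transition (z := fun t i => quatLog (rot (x t i))) hT
    fun t ht i => hx.hasDerivWithinAt_quatLog ht.1 (h t ht i)) i

/-- The outputs stay in the smallest ball around `0` containing the initial ones, whose radius is
less than `π`. So the real parts of the rotations are bounded away from `-1`, up to and including
the first time at which a rotation could become `-1`. -/
theorem rot_ne_neg_one {t : ℝ} (ht : 0 ≤ t) (i : Fin n) : rot (x t i) ≠ -1 := by
  intro hbad
  obtain ⟨i₁, -, hi₁⟩ := Finset.exists_max_image Finset.univ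
    (fun j => ‖quatLog (rot (x 0 j))‖) ⟨i, Finset.mem_univ i⟩
  set ρ := ‖quatLog (rot (x 0 i₁))‖ with hρ
  have hρπ : ρ < Real.pi := norm_quatLog_lt (norm_rot (hx.initial i₁).1) (hx.initial i₁).2
  -- the set of times with a rotation `-1` is closed, and `T` is the first of them
  set S : Set ℝ := ⋃ j, Set.Ici 0 ∩ (fun t => rot (x t j)) ⁻¹' {-1} with hS
  have hclosed : IsClosed S := isClosed_iUnion_of_finite fun j =>
    (hx.continuousOn_rot j).preimage_isClosed_of_isClosed isClosed_Ici isClosed_singleton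
  have hS0 : ∀ s ∈ S, 0 ≤ s := fun s hs => by
    obtain ⟨j, hj, -⟩ := Set.mem_iUnion.1 hs
    exact hj
  have hbdd : BddBelow S := ⟨0, hS0⟩
  have hTmem : sInf S ∈ S := hclosed.csInf_mem ⟨t, Set.mem_iUnion.2 ⟨i, ht, hbad⟩⟩ hbdd
  set T := sInf S with hT
  have hbefore : ∀ s, 0 ≤ s → s < T → ∀ j, rot (x s j) ≠ -1 := fun s hs hsT j h =>
    (csInf_le hbdd (Set.mem_iUnion.2 ⟨j, hs, h⟩)).not_gt hsT
  obtain ⟨k, hT0, hk⟩ := Set.mem_iUnion.1 hTmem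
  have hTpos : 0 < T := lt_of_le_of_ne hT0 fun h => (hx.initial k).2 (by rw [h]; exact hk)
  have hcos : ∀ s ∈ Set.Ico 0 T, Real.cos ρ ≤ (rot (x s k)).re := fun s hs => by
    have h1 : ‖quatLog (rot (x s k))‖ ≤ ρ := by
      rw [hx.quatLog_eq_of_forall hs.1
        (fun u hu j => hbefore u hu.1 (hu.2.trans_lt hs.2) j) k]
      exact norm_act_transition_le G.a_nonneg hs.1 (fun j => hi₁ j (Finset.mem_univ j)) k
    rw [← exp_quatLog (norm_rot (hx.unit s hs.1 k)) (hbefore s hs.1 hs.2 k),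
      re_exp_of_re_eq_zero (quatLog_re _)]
    exact Real.cos_le_cos_of_nonneg_of_le_pi (norm_nonneg _) hρπ.le h1
  have hlim : Tendsto (fun s => (rot (x s k)).re) (𝓝[Set.Ico 0 T] T) (𝓝 (rot (x T k)).re) :=
    (Quaternion.continuous_re.tendsto _).comp
      (((hx.continuousOn_rot k) T hT0).mono fun s hs => hs.1)
  have : (𝓝[Set.Ico 0 T] T).NeBot := by
    rw [← mem_closure_iff_nhdsWithin_neBot, closure_Ico hTpos.ne]
    exact ⟨hT0, le_rfl⟩
  have h2 := ge_of_tendsto hlim (eventually_mem_nhdsWithin.mono hcos)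
  have h3 : rot (x T k) = -1 := hk
  have h4 := Real.cos_lt_cos_of_nonneg_of_le_pi (norm_nonneg _) le_rfl hρπ
  rw [h3, Quaternion.re_neg, Quaternion.re_one] at h2
  rw [Real.cos_pi] at h4
  exact h2.not_gt h4

theorem mem_logDomain {t : ℝ} (ht : 0 ≤ t) (i : Fin n) : x t i ∈ logDomain :=
  ⟨hx.unit t ht i, hx.rot_ne_neg_one ht i⟩

theorem quatLog_eq {t : ℝ} (ht : 0 ≤ t) (i : Fin n) :
    quatLog (rot (x t i)) = act (transition G.a t) (fun j => quatLog (rot (x 0 j))) i :=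
  hx.quatLog_eq_of_forall ht (fun _ hs j => hx.rot_ne_neg_one hs.1 j) i

theorem outputConsensus_iff : OutputConsensus x ↔ ∀ i j,
    Tendsto (fun t => act (transition G.a t) (fun j => quatLog (rot (x 0 j))) i -
      act (transition G.a t) (fun j => quatLog (rot (x 0 j))) j) atTop (𝓝 0) ∧
    Tendsto (fun t => act (transition G.a t) (fun j => halfTrans (x 0 j)) i -
      act (transition G.a t) (fun j => halfTrans (x 0 j)) j) atTop (𝓝 0) := by
  refine forall₂_congr fun i j => ?_
  have h : (fun t => logDQ (x t i) - logDQ (x t j)) =ᶠ[atTop] fun t => mkDQ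
      (act (transition G.a t) (fun j => quatLog (rot (x 0 j))) i -
        act (transition G.a t) (fun j => quatLog (rot (x 0 j))) j)
      (act (transition G.a t) (fun j => halfTrans (x 0 j)) i -
        act (transition G.a t) (fun j => halfTrans (x 0 j)) j) := by
    filter_upwards [eventually_ge_atTop 0] with t ht
    rw [logDQ_eq, logDQ_eq, mkDQ_sub, hx.quatLog_eq ht, hx.quatLog_eq ht, hx.halfTrans_eq ht,
      hx.halfTrans_eq ht]
  rw [tendsto_congr' h]
  constructor
  · intro h
    refine ⟨((TrivSqZeroExt.continuous_fst.tendsto _).comp h).congr fun t => fst_mkDQ _ _,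
      ((TrivSqZeroExt.continuous_snd.tendsto _).comp h).congr fun t => snd_mkDQ _ _⟩
  · rintro ⟨h1, h2⟩
    have h0 : mkDQ 0 0 = 0 := by simp [mkDQ]
    rw [← h0]
    exact tendsto_mkDQ h1 h2

theorem poseConsensus (hn : 0 < n) (h : OutputConsensus x) : PoseConsensus x := by
  have : Nonempty (Fin n) := ⟨⟨0, hn⟩⟩
  rw [hx.outputConsensus_iff] at h
  obtain ⟨c, hc⟩ := exists_tendsto_act_transition G.a_nonneg fun i j => (h i j).1
  obtain ⟨d, hd⟩ := exists_tendsto_act_transition G.a_nonneg fun i j => (h i j).2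
  have hc' : ∀ i, Tendsto (fun t => quatLog (rot (x t i))) atTop (𝓝 c) := fun i =>
    (hc i).congr' ((eventually_ge_atTop 0).mono fun t ht => (hx.quatLog_eq ht i).symm)
  have hd' : ∀ i, Tendsto (fun t => halfTrans (x t i)) atTop (𝓝 d) := fun i =>
    (hd i).congr' ((eventually_ge_atTop 0).mono fun t ht => (hx.halfTrans_eq ht i).symm)
  have hcre : c.re = 0 := tendsto_nhds_unique
    ((Quaternion.continuous_re.tendsto c).comp (hc' ⟨0, hn⟩))
    (tendsto_const_nhds.congr fun t => (quatLog_re _).symm)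
  have hdre : d.re = 0 := tendsto_nhds_unique
    ((Quaternion.continuous_re.tendsto d).comp (hd' ⟨0, hn⟩))
    (tendsto_const_nhds.congr' ((eventually_ge_atTop 0).mono fun t ht =>
      (halfTrans_re (hx.unit t ht _)).symm))
  refine ⟨poseExp c d, poseExp_mem_unitDQ hcre hdre, fun i => ?_⟩
  have hexp : Tendsto (fun t => NormedSpace.exp (quatLog (rot (x t i)))) atTop
      (𝓝 (NormedSpace.exp c)) :=
    (NormedSpace.exp_analytic (𝕂 := ℝ) c).continuousAt.tendsto.comp (hc' i)
  refine (tendsto_mkDQ hexp ((hd' i).mul hexp)).congr' ?_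
  exact (eventually_ge_atTop 0).mono fun t ht => poseExp_log (hx.mem_logDomain ht i)

end IsTrajectory

/-! ### Existence of trajectories, and consensus -/

/-- Real linear combinations of pure quaternions are pure. -/
theorem act_re {P : Matrix (Fin n) (Fin n) ℝ} {z : Fin n → ℍ[ℝ]} (hz : ∀ j, (z j).re = 0)
    (i : Fin n) : (act P z i).re = 0 := by
  have : ∀ q : ℍ[ℝ], q.re = vec4CLE q 0 := fun _ => rfl
  rw [this, act, map_sum]
  simp only [Finset.sum_apply, map_smul, Pi.smul_apply, ← this, hz]
  simp

theorem exists_isTrajectory (G : WeightedDigraph n) {x₀ : Fin n → DualQuat}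
    (h₀ : ∀ i, x₀ i ∈ logDomain) : ∃ x : ℝ → Fin n → DualQuat, IsTrajectory G x ∧ x 0 = x₀ := by
  set v : ℝ → Fin n → ℍ[ℝ] :=
    fun t => act (transition G.a t) fun j => quatLog (rot (x₀ j)) with hv
  set w : ℝ → Fin n → ℍ[ℝ] := fun t => act (transition G.a t) fun j => halfTrans (x₀ j) with hw
  have hvre : ∀ t i, (v t i).re = 0 := fun t i => act_re (fun j => quatLog_re _) i
  have hwre : ∀ t i, (w t i).re = 0 := fun t i => act_re (fun j => halfTrans_re (h₀ j).1) i
  have hx0 : (fun i => poseExp (v 0 i) (w 0 i)) = x₀ := by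
    funext i
    simp only [hv, hw, transition_zero, one_act]
    exact poseExp_log (h₀ i)
  refine ⟨fun t i => poseExp (v t i) (w t i), ⟨?_, ?_, ?_⟩, hx0⟩
  · exact fun t _ i => poseExp_mem_unitDQ (hvre t i) (hwre t i)
  · intro i
    rw [show poseExp (v 0 i) (w 0 i) = x₀ i from congrFun hx0 i]
    exact h₀ i
  · intro t ht i
    have hπ : ∀ i, ‖v t i‖ < Real.pi := fun i => by
      obtain ⟨i₁, -, hi₁⟩ := Finset.exists_max_image Finset.univ
        (fun j => ‖quatLog (rot (x₀ j))‖) ⟨i, Finset.mem_univ i⟩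
      exact (norm_act_transition_le G.a_nonneg ht (fun j => hi₁ j (Finset.mem_univ j)) i).trans_lt
        (norm_quatLog_lt (norm_rot (h₀ i₁).1) (h₀ i₁).2)
    rw [protocolInput_eq, hasDerivWithinAt_vec8_iff (x := fun s => poseExp (v s i) (w s i))]
    simp only [rot_poseExp, snd_poseExp, quatLog_exp (hvre t _) (hπ _),
      halfTrans_poseExp (hvre t _)]
    have hdv := (hasDerivAt_act_transition G.a (fun j => quatLog (rot (x₀ j))) t
      i).hasDerivWithinAt (s := Set.Ici 0)
    have hdw := (hasDerivAt_act_transition G.a (fun j => halfTrans (x₀ j)) t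
      i).hasDerivWithinAt (s := Set.Ici 0)
    have h1 := hasDerivWithinAt_vec4_exp (v := fun s => v s i) (fun s => hvre s i) (hπ i) hdv
    refine ⟨h1, ?_⟩
    have h2 : HasDerivWithinAt (fun s => NormedSpace.exp (v s i)) _ (Set.Ici 0) t :=
      vec4CLE.symm.hasFDerivAt.comp_hasDerivWithinAt t h1
    refine (hdw.mul h2).congr_deriv ?_
    rw [pureOfVec_vec3 (neg_sum_re (hwre t) i), add_comm]
    rfl

/-- Without a common ancestor of `i` and `j`, translate the ancestors of `i` by a fixed vector and
leave all other agents at the identity: then neither `i` nor `j` ever moves. -/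
theorem exists_common_ancestor
    (h : ∀ x : ℝ → Fin n → DualQuat, IsTrajectory G x → OutputConsensus x) (i j : Fin n) :
    ∃ k, Relation.ReflTransGen G.Adj k i ∧ Relation.ReflTransGen G.Adj k j := by
  classical
  by_contra! hno
  set e : ℍ[ℝ] := ⟨0, 1, 0, 0⟩ with he
  set w : Fin n → ℍ[ℝ] := fun k => if Relation.ReflTransGen G.Adj k i then e else 0 with hw
  have hwre : ∀ k, (w k).re = 0 := fun k => by
    simp only [hw]
    split_ifs <;> rfl
  obtain ⟨x, hx, hx0⟩ := exists_isTrajectory G (x₀ := fun k => poseExp 0 (w k))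
    fun k => poseExp_mem_logDomain rfl (hwre k) (by simpa using Real.pi_pos)
  have hlim := ((hx.outputConsensus_iff.1 (h x hx)) i j).2
  have hx0w : (fun k => halfTrans (x 0 k)) = w := by
    funext k
    rw [hx0]
    exact halfTrans_poseExp rfl
  have hi : ∀ t, act (transition G.a t) w i = e := fun t => by
    have : ∀ k, transition G.a t i k • w k = transition G.a t i k • e := fun k => by
      by_cases hk : Relation.ReflTransGen G.Adj k i
      · simp [hw, hk]
      · rw [transition_eq_zero t (by rwa [G.adj_eq] at hk), zero_smul, zero_smul]
    simp only [act, this, ← Finset.sum_smul, transition_row_sum, one_smul]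
  have hj : ∀ t, act (transition G.a t) w j = 0 := fun t => by
    refine Finset.sum_eq_zero fun k _ => ?_
    by_cases hk : Relation.ReflTransGen G.Adj k i
    · have := hno k hk
      rw [transition_eq_zero t (by rwa [G.adj_eq] at this), zero_smul]
    · simp [hw, hk]
  rw [hx0w] at hlim
  simp only [hi, hj, sub_zero] at hlim
  have h0 := tendsto_nhds_unique hlim tendsto_const_nhds
  have := congrArg (fun q : ℍ[ℝ] => q.imI) h0
  simp [he] at this

theorem outputConsensus_iff_hasDirectedSpanningTree (hn : 0 < n) (G : WeightedDigraph n) :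
    (∀ x : ℝ → Fin n → DualQuat, IsTrajectory G x → OutputConsensus x) ↔
      HasDirectedSpanningTree G.toDigraph := by
  have : Nonempty (Fin n) := ⟨⟨0, hn⟩⟩
  rw [hasDirectedSpanningTree_iff]
  constructor
  · exact fun h => exists_forall_reflTransGen (exists_common_ancestor h)
  · rintro ⟨r, hr⟩ x hx
    rw [G.adj_eq] at hr
    exact hx.outputConsensus_iff.2 fun i j =>
      ⟨tendsto_act_transition_sub G.a_nonneg hr _ i j,
        tendsto_act_transition_sub G.a_nonneg hr _ i j⟩

end RigidBody

end

theorem mainTheorem1 (n : ℕ) (hn : 0 < n) (G : RigidBody.WeightedDigraph n) :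
    -- every initial configuration with logarithms starts a trajectory defined for all `t ≥ 0`
    (∀ x₀ : Fin n → RigidBody.DualQuat, (∀ i, x₀ i ∈ RigidBody.logDomain) →
      ∃ x : ℝ → Fin n → RigidBody.DualQuat, RigidBody.IsTrajectory G x ∧ x 0 = x₀) ∧
    -- along every trajectory the logarithms stay defined
    (∀ x : ℝ → Fin n → RigidBody.DualQuat, RigidBody.IsTrajectory G x →
      ∀ t, 0 ≤ t → ∀ i, x t i ∈ RigidBody.logDomain) ∧
    -- output consensus is achieved if and only if there is a directed spanning tree
    ((∀ x : ℝ → Fin n → RigidBody.DualQuat, RigidBody.IsTrajectory G x →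
        RigidBody.OutputConsensus x) ↔
      RigidBody.HasDirectedSpanningTree G.toDigraph) ∧
    -- output consensus implies pose consensus
    (∀ x : ℝ → Fin n → RigidBody.DualQuat, RigidBody.IsTrajectory G x →
      RigidBody.OutputConsensus x → RigidBody.PoseConsensus x) :=
  ⟨fun _ h₀ => RigidBody.exists_isTrajectory G h₀, fun _ hx _ ht i => hx.mem_logDomain ht i,
    RigidBody.outputConsensus_iff_hasDirectedSpanningTree hn G,
    fun _ hx h => hx.poseConsensus hn h⟩
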